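/- Let $\mathcal H$ be a complex Hilbert space of dimension $n$ and let $\widetilde P=\{p_i,|\psi_i\rangle\langle\psi_i|\}_{i=1}^n$ be an ensemble of $n$ linearly independent unit vectors $\psi_i\in\mathcal H$ with $p_i>0$, $\sum_i p_i=1$. Its Gram matrix is $G_{ij}=\sqrt{p_ip_j}\,\langle\psi_i|\psi_j\rangle$. Put $\widetilde\psi_i=\sqrt{p_i}\,\psi_i$ and let $\widetilde u_j$ be the vectors with $\langle\widetilde\psi_i|\widetilde u_j\rangle=\delta_{ij}$. A POVM $\{E_i\}_{i=1}^n$ (with $E_i\ge0$, $\sum_iE_i=\mathbb 1$) is optimal for $\widetilde P$ if it maximises $\sum_i p_i\langle\psi_i|E_i|\psi_i\rangle$ among all $n$-element POVMs. Let $\mathcal G$ be the set of positive definite complex $n\times n$ matrices of trace one. For $G_q\in\mathcal G$ with diagonal entries $q_i$ put $$C(G_q)=\Big(\sum_{j}\frac{q_j}{(G_q^{1/2})_{jj}}\Big)^{-1},\qquad p'_i=C(G_q)\,\frac{q_i}{(G_q^{1/2})_{ii}},\qquad \mathscr R_{\mathcal G}^{-1}(G_q)_{ij}=\sqrt{p'_ip'_j}\;\frac{(G_q)_{ij}}{\sqrt{q_iq_j}}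 .$$ A rank-one projective solution is an orthonormal basis $\{w_i\}$ of $\mathcal H$ together with a unitary matrix $W$ such that $w_i=\sum_j(G^{1/2}W)_{ji}\,\widetilde u_j$, the phases of the $w_i$ are fixed so that the diagonal entries $d_i=(G^{1/2}W)_{ii}$ are real and nonnegative, and $E_i=|w_i\rangle\langle w_i|$ satisfies the complementary slackness conditions $E_j\big(p_j|\psi_j\rangle\langle\psi_j|-p_i|\psi_i\rangle\langle\psi_i|\big)E_i=0$ for all $i,j$. Put $D=\mathrm{Diag}(d_1,\dots,d_n)$ and $X=DG^{1/2}W$. Then: 1. $\mathscr R_{\mathcal G}^{-1}$ is a bijection of $\mathcal G$ onto $\mathcal G$; denote its inverse by $\mathscr R_{\mathcal G}$. The ensemble $\widetilde P$ has exactly one optimal POVM, and it is $\{|w_i\rangle\langle w_i|\}$ for some rank-one projective solution. 2. For every rank-one projective solution, $X$ is Hermitian, $D^2$ is the diagonal of $X$, and $X^2=DGD$. The measurement $\{|w_i\rangle\langle w_i|\}$ is optimal for $\widetilde P$ if and only if $X$ is positive definite. In that case there is an ensemble $\widetilde Q=\{q_i,|\psi_i\rangle\langle\psi_i|\}_{i=1}^n$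 of the same states, with $q_i>0$ and $\sum_iq_i=1$, whose Gram matrix is $G_q=\mathscr R_{\mathcal G}(G)$ and whose pretty good measurement $\{\rho_q^{-1/2}q_i|\psi_i\rangle\langle\psi_i|\rho_q^{-1/2}\}$, $\rho_q=\sum_iq_i|\psi_i\rangle\langle\psi_i|$, equals $\{|w_i\rangle\langle w_i|\}$. Moreover $X=C\,G_q^{1/2}$ with $C=C(G_q)>0$, and $$\mathscr R_{\mathcal G}(G)=\frac{DGD}{\mathrm{Tr}(D^2G)} .$$ 3. Let $X$ be any Hermitian matrix with $X^2=DGD$, where $D$ is a diagonal matrix with real nonnegative entries and $D^2$ is the diagonal of $X$. Then $X$ is positive definite if and only if it arises as in 2 from a rank-one projective solution whose measurement is optimal for $\widetilde P$; in that case $\mathscr R_{\mathcal G}(G)=DGD/\mathrm{Tr}(D^2G)$. -/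

import Mathlib

open scoped ComplexOrder MatrixOrder

noncomputable section

namespace MED

/-- An ensemble `{p i, |ψ i⟩⟨ψ i|}` of `n` linearly independent pure states which span the Hilbert
space `H` (so `H` has dimension `n`), with strictly positive a priori probabilities. -/
structure Ensemble (n : ℕ) (H : Type*) [NormedAddCommGroup H] [InnerProductSpace ℂ H] where
  p : Fin n → ℝ
  ψ : Fin n → H
  p_pos : ∀ i, 0 < p i
  p_sum : ∑ i, p i = 1
  norm_ψ : ∀ i, ‖ψ i‖ = 1
  indep : LinearIndependent ℂ ψ
  span_top : Submodule.span ℂ (Set.range ψ) = ⊤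

/-- The positive semidefinite square root of a positive semidefinite matrix. -/
def msqrt {n : ℕ} (M : Matrix (Fin n) (Fin n) ℂ) : Matrix (Fin n) (Fin n) ℂ := CFC.sqrt M

section Hilbert

variable {n : ℕ} {H : Type*} [NormedAddCommGroup H] [InnerProductSpace ℂ H]

/-- The operator `|v⟩⟨v|`. -/
def ketbra (v : H) : H →L[ℂ] H := InnerProductSpace.rankOne ℂ v v

/-- The subnormalised state `√(p i) |ψ i⟩`. -/
def Ensemble.tilde (P : Ensemble n H) (i : Fin n) : H := (√(P.p i) : ℂ) • P.ψ i

/-- The Gram matrix `G i j = √(p i) √(p j) ⟨ψ i|ψ j⟩`. -/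
def Ensemble.gram (P : Ensemble n H) : Matrix (Fin n) (Fin n) ℂ := Matrix.gram ℂ P.tilde

/-- The vectors `u j` biorthogonal to the vectors `√(p i) |ψ i⟩`; see `Ensemble.inner_tilde_u`. -/
def Ensemble.u (P : Ensemble n H) (j : Fin n) : H := ∑ k, P.gram⁻¹ k j • P.tilde k

theorem Ensemble.gram_posDef (P : Ensemble n H) : P.gram.PosDef := by
  apply Matrix.posDef_gram_of_linearIndependent
  have h := P.indep.units_smul (fun i => Units.mk0 (√(P.p i) : ℂ) (by
    have := Real.sqrt_pos.2 (P.p_pos i)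
    exact_mod_cast this.ne'))
  exact h

theorem Ensemble.inner_tilde_u (P : Ensemble n H) (i j : Fin n) :
    inner ℂ (P.tilde i) (P.u j) = if i = j then 1 else 0 := by
  have h : P.gram * P.gram⁻¹ = 1 :=
    Matrix.mul_nonsing_inv _ ((Matrix.isUnit_iff_isUnit_det _).1 P.gram_posDef.isUnit)
  have h2 := congrFun (congrFun h i) j
  rw [Matrix.mul_apply, Matrix.one_apply] at h2
  rw [← h2, Ensemble.u, inner_sum]
  refine Finset.sum_congr rfl fun k _ => ?_
  rw [inner_smul_right, mul_comm]
  rfl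

/-- `n`-element positive operator valued measures on `H`. -/
def IsPOVM (E : Fin n → H →L[ℂ] H) : Prop :=
  (∀ i, (E i).IsPositive) ∧ ∑ i, E i = 1

/-- The average probability of success `∑ i, p i ⟨ψ i|E i|ψ i⟩`. -/
def Ensemble.successProb (P : Ensemble n H) (E : Fin n → H →L[ℂ] H) : ℝ :=
  ∑ i, P.p i * (inner ℂ (P.ψ i) (E i (P.ψ i))).re

/-- `E` is optimal for minimum error discrimination of `P`: it maximises the average probability
of success among all `n`-element POVMs. -/
def Ensemble.IsOptimal (P : Ensemble n H) (E : Fin n → H →L[ℂ] H) : Prop :=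
  IsPOVM E ∧ ∀ F : Fin n → H →L[ℂ] H, IsPOVM F → P.successProb F ≤ P.successProb E

/-- The complementary slackness conditions
`E j (p j |ψ j⟩⟨ψ j| - p i |ψ i⟩⟨ψ i|) E i = 0`. -/
def Ensemble.Slack (P : Ensemble n H) (E : Fin n → H →L[ℂ] H) : Prop :=
  ∀ i j, E j * ((P.p j : ℂ) • ketbra (P.ψ j) - (P.p i : ℂ) • ketbra (P.ψ i)) * E i = 0

/-- The rank-one projective measurement of an orthonormal basis. -/
def proj (w : OrthonormalBasis (Fin n) ℂ H) (i : Fin n) : H →L[ℂ] H := ketbra (w i)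

/-- The density operator `∑ i, p i |ψ i⟩⟨ψ i|`. -/
def Ensemble.density (P : Ensemble n H) : H →L[ℂ] H := ∑ i, (P.p i : ℂ) • ketbra (P.ψ i)

/-- The pretty good measurement `ρ^(-1/2) (p i |ψ i⟩⟨ψ i|) ρ^(-1/2)`. -/
def Ensemble.pgm [CompleteSpace H] (P : Ensemble n H) (i : Fin n) : H →L[ℂ] H :=
  Ring.inverse (CFC.sqrt P.density) * ((P.p i : ℂ) • ketbra (P.ψ i)) *
    Ring.inverse (CFC.sqrt P.density)

/-- `w` is an orthonormal basis whose rank-one projective measurement solves the complementary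
slackness conditions, `W` is the unitary matrix which represents it,
`w i = ∑ j, (G^(1/2) W) j i • u j`, and the phases of the `w i` are fixed so that the diagonal of
`G^(1/2) W` is real and nonnegative. -/
structure Ensemble.IsProjSolution (P : Ensemble n H) (w : OrthonormalBasis (Fin n) ℂ H)
    (W : Matrix (Fin n) (Fin n) ℂ) : Prop where
  unitary : W ∈ Matrix.unitaryGroup (Fin n) ℂ
  repr : ∀ i, w i = ∑ j, (msqrt P.gram * W) j i • P.u j
  diag_im : ∀ i, ((msqrt P.gram * W) i i).im = 0
  diag_re : ∀ i, 0 ≤ ((msqrt P.gram * W) i i).re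
  slack : P.Slack (proj w)

/-- The diagonal matrix `D` with the diagonal of `G^(1/2) W`. -/
def Ensemble.D (P : Ensemble n H) (W : Matrix (Fin n) (Fin n) ℂ) : Matrix (Fin n) (Fin n) ℂ :=
  Matrix.diagonal fun i => (msqrt P.gram * W) i i

/-- `X = D G^(1/2) W`. -/
def Ensemble.X (P : Ensemble n H) (W : Matrix (Fin n) (Fin n) ℂ) : Matrix (Fin n) (Fin n) ℂ :=
  P.D W * msqrt P.gram * W

end Hilbert

section Gram

variable {n : ℕ}

/-- Positive definite matrices of trace one. -/
def gramSet (n : ℕ) : Set (Matrix (Fin n) (Fin n) ℂ) := {M | M.PosDef ∧ M.trace = 1}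

/-- `C = (∑ j, q j / (G_q^(1/2)) j j)⁻¹`, where `q j = (G_q) j j`. -/
def normConst (Gq : Matrix (Fin n) (Fin n) ℂ) : ℝ :=
  (∑ j, (Gq j j).re / (msqrt Gq j j).re)⁻¹

/-- `p i = C q i / (G_q^(1/2)) i i`. -/
def priorOf (Gq : Matrix (Fin n) (Fin n) ℂ) (i : Fin n) : ℝ :=
  normConst Gq * ((Gq i i).re / (msqrt Gq i i).re)

/-- The map `G_q ↦ G` which keeps the states and replaces the probabilities `q i` by
`p i = C q i / (G_q^(1/2)) i i`:
`G i j = √(p i p j) ⟨ψ i|ψ j⟩` with `⟨ψ i|ψ j⟩ = (G_q) i j / √(q i q j)`. -/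
def RGinv (Gq : Matrix (Fin n) (Fin n) ℂ) : Matrix (Fin n) (Fin n) ℂ :=
  Matrix.of fun i j =>
    (√(priorOf Gq i * priorOf Gq j) : ℂ) * (Gq i j / (√((Gq i i).re * (Gq j j).re) : ℂ))

/-- The map `R_G` on the positive definite matrices of trace one: the inverse of `RGinv` there. -/
def RG : Matrix (Fin n) (Fin n) ℂ → Matrix (Fin n) (Fin n) ℂ :=
  Function.invFunOn RGinv (gramSet n)

/-- `X` is a Hermitian solution of `X² = D G D`, where `D = diag (d i)` is the nonnegative square
root of the diagonal of `X`. -/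
structure IsMatrixSolution (G X : Matrix (Fin n) (Fin n) ℂ) (d : Fin n → ℝ) : Prop where
  herm : X.IsHermitian
  nonneg : ∀ i, 0 ≤ d i
  diag : ∀ i, X i i = (d i : ℂ) ^ 2
  eq : X * X = Matrix.diagonal (fun i => (d i : ℂ)) * G * Matrix.diagonal (fun i => (d i : ℂ))

end Gram

end MED

end

/-!
Let `M k i = ⟨√(p k) ψ k|w i⟩` be the overlaps of the ensemble with an orthonormal basis `w`. They
run through the factorisations `M Mᴴ = G`, and fixing the phases of the `w i` makes the diagonal
`D` of `M` nonnegative. With `X = D M`, the slackness conditions say that `X` is Hermitian, and the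
success probability of `w` is `Tr X`. In the basis `w` the weighted state `p i |ψ i⟩⟨ψ i|` is
`X e e† X / X i i`, where `e` is the `i`-th standard basis vector, so if `X` is positive definite
it dominates all weighted states: weak duality makes `w` optimal, and equality in the duality
forces every optimal measurement to be `w`. Conversely a maximiser of `∑ i, |(M U) i i|²` over the
compact unitary group produces a factor for which `X` is positive definite.

Hence every positive definite `G` is `D⁻¹ X² D⁻¹`, with `D²` the diagonal of `X`, for exactly one
positive definite `X`. Precomposed with `Q ↦ C Q^(1/2)`, the map `X ↦ D⁻¹ X² D⁻¹` is `R_G⁻¹`, which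
gives its bijectivity, the formula for `R_G`, and the ensemble whose pretty good measurement is
`w`: its probabilities make the overlap matrix equal to `Q^(1/2)`.
-/

noncomputable section

namespace MED

open Matrix

theorem posSemidef_single_one {𝕜 m : Type*} [RCLike 𝕜] [DecidableEq m] (i : m) :
    (single i i (1 : 𝕜)).PosSemidef := by
  rw [← diagonal_single, posSemidef_diagonal_iff]
  exact Pi.single_nonneg.2 zero_le_one

theorem posSemidef_of_forall_nonneg {m : Type*} [Fintype m] {A : Matrix m m ℂ}
    (h : ∀ x : m → ℂ, 0 ≤ star x ⬝ᵥ A *ᵥ x) : A.PosSemidef := by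
  classical
  rw [← isPositive_toEuclideanLin_iff, LinearMap.isPositive_iff_complex]
  intro x
  have hx : 0 ≤ inner ℂ (A.toEuclideanLin x) x := by
    rw [← inner_conj_symm, starRingEnd_apply, star_nonneg_iff,
      EuclideanSpace.inner_eq_star_dotProduct, dotProduct_comm]
    exact h x
  exact ⟨(Complex.eq_re_of_ofReal_le hx).symm, (Complex.nonneg_iff.1 hx).1⟩

section PosSemidef

variable {𝕜 m : Type*} [RCLike 𝕜] [Fintype m] {A B : Matrix m m 𝕜}

theorem exists_eq_conjTranspose_mul_self (hA : A.PosSemidef) : ∃ R : Matrix m m 𝕜, A = Rᴴ * R := by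
  classical exact CStarAlgebra.nonneg_iff_eq_star_mul_self.1 hA.nonneg

theorem trace_mul_nonneg (hA : A.PosSemidef) (hB : B.PosSemidef) : 0 ≤ (A * B).trace := by
  obtain ⟨R, rfl⟩ := exists_eq_conjTranspose_mul_self hA
  rw [Matrix.mul_assoc, trace_mul_comm]
  exact (hB.mul_mul_conjTranspose_same R).trace_nonneg

theorem mul_eq_zero_of_trace_mul_eq_zero (hA : A.PosSemidef) (hB : B.PosSemidef)
    (h : (A * B).trace = 0) : A * B = 0 := by
  obtain ⟨R, rfl⟩ := exists_eq_conjTranspose_mul_self hA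
  obtain ⟨S, rfl⟩ := exists_eq_conjTranspose_mul_self hB
  have hSR : (S * Rᴴ)ᴴ * (S * Rᴴ) = R * (Sᴴ * S) * Rᴴ := by
    simp only [conjTranspose_mul, conjTranspose_conjTranspose, Matrix.mul_assoc]
  rw [Matrix.mul_assoc, trace_mul_comm, ← hSR,
    (posSemidef_conjTranspose_mul_self _).trace_eq_zero_iff, conjTranspose_mul_self_eq_zero] at h
  calc Rᴴ * R * (Sᴴ * S) = Rᴴ * (S * Rᴴ)ᴴ * S := by
        simp only [conjTranspose_mul, conjTranspose_conjTranspose, Matrix.mul_assoc]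
    _ = 0 := by rw [h, conjTranspose_zero, Matrix.mul_zero, Matrix.zero_mul]

-- The difference is `Rᴴ * A * R` for `R = 1 - (A i i)⁻¹ • (single i i 1 * A)`.
theorem posSemidef_sub_inv_smul_mul_single_mul [DecidableEq m] (hA : A.PosSemidef) (i : m) :
    (A - (A i i)⁻¹ • (A * single i i 1 * A)).PosSemidef := by
  have hreal : star (A i i) = A i i := hA.isHermitian.apply i i
  have hsandwich : A * single i i 1 * A * (single i i 1 * A) = A i i • (A * single i i 1 * A) := by
    calc A * single i i 1 * A * (single i i 1 * A)
        = A * (single i i 1 * A * single i i 1) * A := by simp only [Matrix.mul_assoc]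
      _ = A i i • (A * single i i 1 * A) := by
        rw [single_mul_mul_single, one_mul, mul_one, ← mul_one (A i i), ← smul_eq_mul (A i i),
          ← smul_single, Matrix.mul_smul, Matrix.smul_mul, smul_eq_mul, mul_one]
  have hcancel : (A i i)⁻¹ * (A i i)⁻¹ * A i i = (A i i)⁻¹ := by
    rw [mul_right_comm]
    simpa only [inv_inv] using mul_inv_mul_cancel (A i i)⁻¹
  convert hA.conjTranspose_mul_mul_same (1 - (A i i)⁻¹ • (single i i 1 * A)) using 1
  rw [conjTranspose_sub, conjTranspose_smul, conjTranspose_mul, conjTranspose_single, star_one,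
    star_inv₀, hreal, conjTranspose_one, hA.isHermitian.eq, Matrix.sub_mul, Matrix.one_mul,
    Matrix.mul_sub, Matrix.mul_one, Matrix.mul_smul, Matrix.smul_mul, Matrix.sub_mul,
    Matrix.smul_mul, hsandwich, smul_sub, smul_smul, smul_smul, hcancel, ← Matrix.mul_assoc,
    sub_self, sub_zero]

theorem posDef_mul_self (hA : A.PosDef) : (A * A).PosDef := by
  classical
  have h := PosDef.mul_conjTranspose_self A (vecMul_injective_of_isUnit hA.isUnit)
  rwa [hA.isHermitian.eq] at h

section Duality

variable {ι : Type*} [Fintype ι] {E Y : ι → Matrix m m 𝕜} {K : Matrix m m 𝕜}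

theorem trace_sub_sum_trace_mul [DecidableEq m] (hsum : ∑ i, E i = 1) :
    K.trace - ∑ i, (E i * Y i).trace = ∑ i, (E i * (K - Y i)).trace := by
  simp only [Matrix.mul_sub, trace_sub, Finset.sum_sub_distrib]
  simp only [← trace_sum, ← Matrix.sum_mul, hsum, Matrix.one_mul]

theorem sum_trace_mul_le [DecidableEq m] (hE : ∀ i, (E i).PosSemidef) (hsum : ∑ i, E i = 1)
    (hK : ∀ i, (K - Y i).PosSemidef) : ∑ i, (E i * Y i).trace ≤ K.trace := by
  rw [← sub_nonneg, trace_sub_sum_trace_mul hsum]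
  exact Finset.sum_nonneg fun i _ => trace_mul_nonneg (hE i) (hK i)

theorem mul_eq_mul_of_sum_trace_mul_eq [DecidableEq m] (hE : ∀ i, (E i).PosSemidef)
    (hsum : ∑ i, E i = 1) (hK : ∀ i, (K - Y i).PosSemidef)
    (heq : ∑ i, (E i * Y i).trace = K.trace) (i : ι) : E i * K = E i * Y i := by
  have hzero : ∑ i, (E i * (K - Y i)).trace = 0 := by
    rw [← trace_sub_sum_trace_mul hsum, heq, sub_self]
  rw [Finset.sum_eq_zero_iff_of_nonneg fun i _ => trace_mul_nonneg (hE i) (hK i)] at hzero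
  rw [← sub_eq_zero, ← Matrix.mul_sub]
  exact mul_eq_zero_of_trace_mul_eq_zero (hE i) (hK i) (hzero i (Finset.mem_univ i))

end Duality

theorem eq_single_of_sum_eq_one [DecidableEq m] {E : m → Matrix m m 𝕜}
    (hE : ∀ i, (E i).IsHermitian) (hsum : ∑ i, E i = 1)
    (hcol : ∀ i k l, l ≠ i → E i k l = 0) (i : m) : E i = single i i 1 := by
  have hrow (i k l : m) (hk : k ≠ i) : E i k l = 0 := by
    rw [← (hE i).apply, hcol i l k hk, star_zero]
  have hdiag : E i i i = 1 := by
    have h := congr_fun₂ hsum i i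
    rwa [Matrix.sum_apply, Finset.sum_eq_single i (fun j _ hj => hcol j i i hj.symm) (by simp),
      one_apply_eq] at h
  ext k l
  by_cases hk : k = i
  · by_cases hl : l = i
    · rw [hk, hl, hdiag, single_apply_same]
    · rw [hcol i k l hl, single_apply_of_col_ne _ _ (Ne.symm hl)]
  · rw [hrow i k l hk, single_apply_of_row_ne (Ne.symm hk)]

end PosSemidef

section Factor

variable {𝕜 m : Type*} [RCLike 𝕜] [Fintype m] [DecidableEq m] {G M M' : Matrix m m 𝕜}

/-- `M` is a factor of `G` with nonnegative diagonal. The factors of a Gram matrix are the overlap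
matrices `⟨√(p k) ψ k|w i⟩` with orthonormal bases `w`; the condition on the diagonal fixes the
phases of the `w i`. -/
structure IsFactor (G M : Matrix m m 𝕜) : Prop where
  mul_conjTranspose : M * Mᴴ = G
  diag_nonneg : ∀ i, 0 ≤ M i i

/-- The matrix `X = D M`, where `D` is the diagonal of the overlap matrix `M`. Complementary
slackness says that `X` is Hermitian; `X` is then the candidate for the dual optimum. -/
def slackMatrix (M : Matrix m m 𝕜) : Matrix m m 𝕜 := diagonal M.diag * M

theorem slackMatrix_apply (M : Matrix m m 𝕜) (i j : m) : slackMatrix M i j = M i i * M i j :=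
  diagonal_mul _ _ _ _

theorem isUnit_of_isUnit_slackMatrix (h : IsUnit (slackMatrix M)) : IsUnit M :=
  isUnit_of_mul_isUnit_right h

theorem diag_pos_of_posDef_slackMatrix (hX : (slackMatrix M).PosDef) {i : m} (hi : 0 ≤ M i i) :
    0 < M i i := by
  have h := hX.diag_pos (i := i)
  rw [slackMatrix_apply] at h
  exact hi.lt_of_ne' (left_ne_zero_of_mul h.ne')

theorem mul_single_mul_apply (A B : Matrix m m 𝕜) (i k l : m) :
    (A * single i i (1 : 𝕜) * B : Matrix m m 𝕜) k l = A k i * B i l := by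
  simp only [mul_apply, single_apply, mul_ite, mul_one, mul_zero, ite_and, ite_mul, zero_mul,
    Finset.sum_ite_eq, Finset.mem_univ, if_true]

theorem posSemidef_slackMatrix_sub (hX : (slackMatrix M).PosDef) {i : m} (hi : 0 ≤ M i i) :
    (slackMatrix M - Mᴴ * single i i 1 * M).PosSemidef := by
  convert posSemidef_sub_inv_smul_mul_single_mul hX.posSemidef i using 2
  ext k l
  have hne : M i i ≠ 0 := (diag_pos_of_posDef_slackMatrix hX hi).ne'
  rw [Matrix.smul_apply, mul_single_mul_apply, mul_single_mul_apply, ← hX.isHermitian.apply k i,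
    slackMatrix_apply, slackMatrix_apply, slackMatrix_apply, star_mul',
    (IsSelfAdjoint.of_nonneg hi).star_eq, conjTranspose_apply, smul_eq_mul]
  field_simp

theorem trace_mul_conjTranspose_single_mul (A M : Matrix m m 𝕜) (i : m) :
    (A * (Mᴴ * single i i 1 * M)).trace = (M * A * Mᴴ) i i := by
  rw [← Matrix.mul_assoc, trace_mul_comm, ← Matrix.mul_assoc, ← Matrix.mul_assoc,
    trace_mul_single, MulOpposite.op_one, one_smul]

section POVM

variable {E : m → Matrix m m 𝕜} (hE : ∀ i, (E i).PosSemidef) (hsum : ∑ i, E i = 1)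
  (hX : (slackMatrix M).PosDef) (hM : ∀ i, 0 ≤ M i i)

include hE hsum hX hM

theorem sum_mul_mul_conjTranspose_le_trace_slackMatrix :
    ∑ i, (M * E i * Mᴴ) i i ≤ (slackMatrix M).trace := by
  simp only [← trace_mul_conjTranspose_single_mul]
  exact sum_trace_mul_le hE hsum fun i => posSemidef_slackMatrix_sub hX (hM i)

theorem eq_single_of_sum_mul_mul_conjTranspose_eq
    (heq : ∑ i, (M * E i * Mᴴ) i i = (slackMatrix M).trace) (i : m) : E i = single i i 1 := by
  refine eq_single_of_sum_eq_one (fun i => (hE i).isHermitian) hsum (fun i k l hl => ?_) i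
  simp only [← trace_mul_conjTranspose_single_mul] at heq
  have hEX : E i * diagonal M.diag * M = E i * (Mᴴ * single i i 1) * M := by
    have h := mul_eq_mul_of_sum_trace_mul_eq hE hsum
      (fun i => posSemidef_slackMatrix_sub hX (hM i)) heq i
    rwa [slackMatrix, ← Matrix.mul_assoc, ← Matrix.mul_assoc] at h
  have hED := (isUnit_of_isUnit_slackMatrix hX.isUnit).mul_right_cancel hEX
  have hkl := congr_fun₂ hED k l
  rw [mul_diagonal, ← Matrix.mul_assoc, mul_single_apply_of_ne _ _ _ _ _ hl] at hkl
  exact (mul_eq_zero.1 hkl).resolve_right (diag_pos_of_posDef_slackMatrix hX (hM l)).ne'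

end POVM

theorem apply_eq_zero_of_mul_single_mul {U : Matrix m m 𝕜}
    (hU : ∀ i, U * single i i 1 * Uᴴ = single i i 1) {k i : m} (hki : k ≠ i) : U k i = 0 := by
  have hk := congr_fun₂ (hU i) k k
  rwa [mul_single_mul_apply, conjTranspose_apply, single_apply_of_row_ne hki.symm,
    RCLike.star_def, RCLike.mul_conj, sq_eq_zero_iff, RCLike.ofReal_eq_zero, norm_eq_zero] at hk

theorem eq_one_of_mul_single_mul {U : Matrix m m 𝕜}
    (hU : ∀ i, U * single i i 1 * Uᴴ = single i i 1) (hdiag : ∀ i, 0 ≤ U i i) : U = 1 := by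
  ext k i
  by_cases hki : k = i
  · have hsq : U i i * U i i = 1 := by
      have hi := congr_fun₂ (hU i) i i
      rwa [mul_single_mul_apply, conjTranspose_apply, (IsSelfAdjoint.of_nonneg (hdiag i)).star_eq,
        single_apply_same] at hi
    have hne : U i i ≠ -1 := fun h => absurd (h ▸ hdiag i) (by norm_num)
    rw [hki, one_apply_eq, (mul_self_eq_one_iff.1 hsq).resolve_right hne]
  · rw [apply_eq_zero_of_mul_single_mul hU hki, one_apply_ne hki]

theorem exists_mul_eq_of_mul_conjTranspose_eq (hM : IsUnit M) (h : M * Mᴴ = M' * M'ᴴ) :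
    ∃ U, U * Uᴴ = 1 ∧ M * U = M' := by
  have hMM' : M * (M⁻¹ * M') = M' := by
    rw [← Matrix.mul_assoc, mul_nonsing_inv _ ((isUnit_iff_isUnit_det _).1 hM), Matrix.one_mul]
  refine ⟨M⁻¹ * M', hM.mul_left_cancel (((isUnit_conjTranspose M).2 hM).mul_right_cancel ?_), hMM'⟩
  calc M * (M⁻¹ * M' * (M⁻¹ * M')ᴴ) * Mᴴ
      = M * (M⁻¹ * M') * (M * (M⁻¹ * M'))ᴴ := by simp only [conjTranspose_mul, Matrix.mul_assoc]
    _ = M * 1 * Mᴴ := by rw [hMM', Matrix.mul_one, h]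

theorem IsFactor.eq_of_trace_le (h : IsFactor G M) (h' : IsFactor G M')
    (hX : (slackMatrix M).PosDef) (hle : (slackMatrix M).trace ≤ (slackMatrix M').trace) :
    M = M' := by
  obtain ⟨U, hU, rfl⟩ := exists_mul_eq_of_mul_conjTranspose_eq
    (isUnit_of_isUnit_slackMatrix hX.isUnit) (h.mul_conjTranspose.trans h'.mul_conjTranspose.symm)
  have hE (i : m) : (U * single i i 1 * Uᴴ).PosSemidef :=
    (posSemidef_single_one i).mul_mul_conjTranspose_same U
  have hsum : ∑ i, U * single i i 1 * Uᴴ = 1 := by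
    rw [← Matrix.sum_mul, ← Matrix.mul_sum, sum_single_one, Matrix.mul_one, hU]
  have heq : ∑ i, (M * (U * single i i 1 * Uᴴ) * Mᴴ : Matrix m m 𝕜) i i =
      (slackMatrix M).trace := by
    refine (sum_mul_mul_conjTranspose_le_trace_slackMatrix hE hsum hX h.diag_nonneg).antisymm
      (hle.trans_eq ?_)
    refine Finset.sum_congr rfl fun i _ => ?_
    have hassoc : M * (U * single i i (1 : 𝕜) * Uᴴ) * Mᴴ = M * U * single i i 1 * (M * U)ᴴ := by
      simp only [conjTranspose_mul, Matrix.mul_assoc]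
    rw [hassoc, mul_single_mul_apply, conjTranspose_apply, diag_apply, slackMatrix_apply,
      (IsSelfAdjoint.of_nonneg (h'.diag_nonneg i)).star_eq]
  have hsingle := eq_single_of_sum_mul_mul_conjTranspose_eq hE hsum hX h.diag_nonneg heq
  have hMU (i : m) : (M * U) i i = M i i * U i i := by
    refine Finset.sum_eq_single i (fun k _ hki => ?_) (by simp)
    exact mul_eq_zero_of_right _ (apply_eq_zero_of_mul_single_mul hsingle hki)
  have hUdiag (i : m) : 0 ≤ U i i := by
    refine le_of_mul_le_mul_left ?_ (diag_pos_of_posDef_slackMatrix hX (h.diag_nonneg i))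
    rw [mul_zero, ← hMU]
    exact h'.diag_nonneg i
  rw [eq_one_of_mul_single_mul hsingle hUdiag, Matrix.mul_one]

end Factor

section Existence

variable {𝕜 m : Type*} [RCLike 𝕜] [Fintype m] [DecidableEq m]

theorem isCompact_unitaryGroup : IsCompact (unitaryGroup m 𝕜 : Set (Matrix m m 𝕜)) := by
  refine (isCompact_closedBall (0 : 𝕜) 1).matrix.of_isClosed_subset isClosed_unitary ?_
  intro U hU i j
  exact mem_closedBall_zero_iff.2 (entry_norm_bound_of_unitary hU i j)

theorem diagonal_mem_unitaryGroup {z : m → 𝕜} (hz : ∀ i, ‖z i‖ = 1) :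
    diagonal z ∈ unitaryGroup m 𝕜 := by
  rw [mem_unitaryGroup_iff, star_eq_conjTranspose, diagonal_conjTranspose, diagonal_mul_diagonal,
    ← diagonal_one]
  congr 1
  ext i
  rw [Pi.star_apply, RCLike.star_def, RCLike.mul_conj, hz, RCLike.ofReal_one, one_pow]

theorem exists_isFactor_forall_sum_norm_sq_le {G : Matrix m m 𝕜} (hG : G.PosSemidef) :
    ∃ M, IsFactor G M ∧
      ∀ U ∈ unitaryGroup m 𝕜, ∑ i, ‖(M * U) i i‖ ^ 2 ≤ ∑ i, ‖M i i‖ ^ 2 := by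
  obtain ⟨R, rfl⟩ := exists_eq_conjTranspose_mul_self hG
  obtain ⟨V, hV, hmax⟩ := isCompact_unitaryGroup.exists_isMaxOn ⟨1, one_mem (unitaryGroup m 𝕜)⟩
    (f := fun V => ∑ i, ‖(Rᴴ * V) i i‖ ^ 2) (by fun_prop)
  choose z hz hzV using fun i => RCLike.exists_norm_eq_mul_self ((Rᴴ * V) i i)
  have hVz : V * diagonal z ∈ unitaryGroup m 𝕜 := mul_mem hV (diagonal_mem_unitaryGroup hz)
  have hdiag (i : m) : (Rᴴ * (V * diagonal z)) i i = ‖(Rᴴ * V) i i‖ := by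
    rw [← Matrix.mul_assoc, mul_diagonal, hzV, mul_comm]
  refine ⟨Rᴴ * (V * diagonal z), ⟨?_, fun i => ?_⟩, fun U hU => ?_⟩
  · rw [conjTranspose_mul, Matrix.mul_assoc, ← Matrix.mul_assoc _ _ Rᴴᴴ,
      ← star_eq_conjTranspose (V * _), mem_unitaryGroup_iff.1 hVz, Matrix.one_mul,
      conjTranspose_conjTranspose]
  · rw [hdiag]
    exact RCLike.ofReal_nonneg.2 (norm_nonneg _)
  · simp only [hdiag, Matrix.mul_assoc Rᴴ, RCLike.norm_ofReal, abs_norm]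
    exact hmax (mul_mem hVz hU)

theorem re_trace_slackMatrix_mul_le {M : Matrix m m 𝕜} (hM : ∀ i, 0 ≤ M i i)
    (hmax : ∀ U ∈ unitaryGroup m 𝕜, ∑ i, ‖(M * U) i i‖ ^ 2 ≤ ∑ i, ‖M i i‖ ^ 2)
    {U : Matrix m m 𝕜} (hU : U ∈ unitaryGroup m 𝕜) :
    RCLike.re (slackMatrix M * U).trace ≤ RCLike.re (slackMatrix M).trace := by
  have hterm (i : m) : RCLike.re (M i i * (M * U) i i) ≤ (‖M i i‖ ^ 2 + ‖(M * U) i i‖ ^ 2) / 2 :=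
    calc RCLike.re (M i i * (M * U) i i) ≤ ‖M i i * (M * U) i i‖ := RCLike.re_le_norm _
      _ = ‖M i i‖ * ‖(M * U) i i‖ := norm_mul _ _
      _ ≤ (‖M i i‖ ^ 2 + ‖(M * U) i i‖ ^ 2) / 2 := by
        linarith [two_mul_le_add_sq ‖M i i‖ ‖(M * U) i i‖]
  have hsq (i : m) : RCLike.re (M i i * M i i) = ‖M i i‖ ^ 2 := by
    nth_rw 1 [← (IsSelfAdjoint.of_nonneg (hM i)).star_eq]
    rw [RCLike.star_def, RCLike.conj_mul, ← RCLike.ofReal_pow, RCLike.ofReal_re]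
  calc RCLike.re (slackMatrix M * U).trace = ∑ i, RCLike.re (M i i * (M * U) i i) := by
        rw [slackMatrix, Matrix.mul_assoc, trace, map_sum]
        simp only [diag_apply, diagonal_mul]
    _ ≤ ∑ i, (‖M i i‖ ^ 2 + ‖(M * U) i i‖ ^ 2) / 2 := Finset.sum_le_sum fun i _ => hterm i
    _ = (∑ i, ‖M i i‖ ^ 2 + ∑ i, ‖(M * U) i i‖ ^ 2) / 2 := by
        rw [← Finset.sum_div, Finset.sum_add_distrib]
    _ ≤ ∑ i, ‖M i i‖ ^ 2 := by linarith [hmax U hU]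
    _ = RCLike.re (slackMatrix M).trace := by
        simp only [trace, map_sum, diag_apply, slackMatrix_apply, hsq]

theorem permMatrix_mem_unitaryGroup (σ : Equiv.Perm m) :
    Equiv.Perm.permMatrix 𝕜 σ ∈ unitaryGroup m 𝕜 := by
  rw [mem_unitaryGroup_iff, star_eq_conjTranspose, conjTranspose_permMatrix, ← permMatrix_mul,
    inv_mul_cancel, permMatrix_one]

-- If `M i i = 0`, then `M j j = 0` for some `j` with `M j i ≠ 0`, and exchanging the columns `i`
-- and `j` increases the sum.
theorem diag_pos_of_forall_sum_norm_sq_le {M : Matrix m m 𝕜} (hM : ∀ i, 0 ≤ M i i)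
    (hmax : ∀ U ∈ unitaryGroup m 𝕜, ∑ i, ‖(M * U) i i‖ ^ 2 ≤ ∑ i, ‖M i i‖ ^ 2)
    (hunit : IsUnit M) (hX : (slackMatrix M).IsHermitian) (i : m) : 0 < M i i := by
  refine (hM i).lt_of_ne' fun hi => ?_
  obtain ⟨j, hj⟩ : ∃ j, M j i ≠ 0 := by
    by_contra! hcol
    exact ((isUnit_iff_isUnit_det M).1 hunit).ne_zero (det_eq_zero_of_column_eq_zero i hcol)
  have hjj : M j j = 0 := by
    have h := hX.apply j i
    rw [slackMatrix_apply, slackMatrix_apply, hi, zero_mul, star_zero] at h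
    exact (mul_eq_zero.1 h.symm).resolve_right hj
  have hswap (k : m) :
      (M * (Equiv.swap i j).permMatrix 𝕜) k k = M k (Equiv.swap i j k) := by
    rw [Equiv.Perm.permMatrix, PEquiv.mul_toMatrix_toPEquiv, submatrix_apply, Equiv.symm_swap, id]
  refine (hmax _ (permMatrix_mem_unitaryGroup (Equiv.swap i j))).not_gt ?_
  simp only [hswap]
  refine Finset.sum_lt_sum (fun k _ => ?_) ⟨j, Finset.mem_univ j, ?_⟩
  · by_cases hk : M k k = 0
    · rw [hk, norm_zero, zero_pow two_ne_zero]
      positivity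
    · rw [Equiv.swap_apply_of_ne_of_ne (by rintro rfl; exact hk hi)
        (by rintro rfl; exact hk hjj)]
  · rw [hjj, norm_zero, zero_pow two_ne_zero, Equiv.swap_apply_right]
    positivity

section Complex

variable {A : Matrix m m ℂ}

-- For `x ≠ 0` this matrix multiplies `x` by the phase `z` and fixes its orthogonal complement.
theorem one_add_smul_vecMulVec_mem_unitaryGroup (x : m → ℂ) {z : ℂ} (hz : ‖z‖ = 1) :
    1 + ((z - 1) / (star x ⬝ᵥ x)) • vecMulVec x (star x) ∈ unitaryGroup m ℂ := by
  have hN : star (star x ⬝ᵥ x) = star x ⬝ᵥ x :=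
    (IsSelfAdjoint.of_nonneg (dotProduct_star_self_nonneg x)).star_eq
  set N := star x ⬝ᵥ x
  set c := (z - 1) / N
  have hc : c + star c + c * star c * N = 0 := by
    rcases eq_or_ne N 0 with h0 | h0
    · simp [c, h0]
    · have hzz : z * star z = 1 := by
        rw [RCLike.star_def, RCLike.mul_conj, hz, RCLike.ofReal_one, one_pow]
      simp only [c, star_div₀, star_sub, star_one, hN]
      field_simp
      linear_combination hzz
  rw [mem_unitaryGroup_iff, star_eq_conjTranspose]
  calc (1 + c • vecMulVec x (star x)) * (1 + c • vecMulVec x (star x))ᴴ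
      = 1 + (c + star c + c * star c * N) • vecMulVec x (star x) := by
        simp only [conjTranspose_add, conjTranspose_one, conjTranspose_smul,
          conjTranspose_vecMulVec, star_star, Matrix.mul_add, Matrix.add_mul, Matrix.one_mul,
          Matrix.mul_one, Matrix.mul_smul, Matrix.smul_mul, vecMulVec_mul_vecMulVec,
          vecMulVec_smul, smul_smul, add_smul]
        match_scalars <;> ring
    _ = 1 := by rw [hc, zero_smul, add_zero]

theorem posSemidef_of_re_trace_mul_le
    (h : ∀ U ∈ unitaryGroup m ℂ, (A * U).trace.re ≤ A.trace.re) : A.PosSemidef := by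
  refine posSemidef_of_forall_nonneg fun x => ?_
  rcases eq_or_ne x 0 with rfl | hx
  · simp
  set a := star x ⬝ᵥ A *ᵥ x
  obtain ⟨N, hN, hNx⟩ : ∃ N : ℝ, 0 < N ∧ (N : ℂ) = star x ⬝ᵥ x :=
    RCLike.pos_iff_exists_ofReal.1 (dotProduct_star_self_pos_iff.2 hx)
  obtain ⟨z, hz, hza⟩ : ∃ z : ℂ, ‖z‖ = 1 ∧ (‖a‖ : ℂ) = z * a :=
    RCLike.exists_norm_eq_mul_self a
  have htrace : (A * (1 + ((z - 1) / (star x ⬝ᵥ x)) • vecMulVec x (star x))).trace =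
      A.trace + (‖a‖ - a) / N := by
    rw [hza, ← hNx, Matrix.mul_add, Matrix.mul_one, Matrix.mul_smul, mul_vecMulVec, trace_add,
      trace_smul, trace_vecMulVec, dotProduct_comm, smul_eq_mul, div_mul_eq_mul_div, sub_mul,
      one_mul]
  have hre : ‖a‖ ≤ a.re := by
    have hU := h _ (one_add_smul_vecMulVec_mem_unitaryGroup x hz)
    rw [htrace, Complex.add_re, Complex.div_ofReal_re, Complex.sub_re, Complex.ofReal_re,
      add_le_iff_nonpos_right, div_le_iff₀ hN, zero_mul] at hU
    exact sub_nonpos.1 hU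
  rw [RCLike.norm_le_re_iff_eq_norm.1 hre]
  exact RCLike.ofReal_nonneg.2 (norm_nonneg a)

theorem exists_isFactor_posDef_slackMatrix {G : Matrix m m ℂ} (hG : G.PosDef) :
    ∃ M, IsFactor G M ∧ (slackMatrix M).PosDef := by
  obtain ⟨M, hM, hmax⟩ := exists_isFactor_forall_sum_norm_sq_le hG.posSemidef
  have hunit : IsUnit M := isUnit_of_mul_isUnit_left (hM.mul_conjTranspose ▸ hG.isUnit)
  have hX : (slackMatrix M).PosSemidef := posSemidef_of_re_trace_mul_le fun U hU =>
    re_trace_slackMatrix_mul_le hM.diag_nonneg hmax hU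
  have hdiag : IsUnit (diagonal M.diag) := by
    rw [isUnit_diagonal, Pi.isUnit_iff]
    exact fun i =>
      (diag_pos_of_forall_sum_norm_sq_le hM.diag_nonneg hmax hunit hX.isHermitian i).ne'.isUnit
  exact ⟨M, hM, hX.posDef_iff_isUnit.2 (hdiag.mul hunit)⟩

end Complex

end Existence

section Msqrt

variable {n : ℕ} {A B : Matrix (Fin n) (Fin n) ℂ}

theorem posSemidef_msqrt (A : Matrix (Fin n) (Fin n) ℂ) : (msqrt A).PosSemidef :=
  (CFC.sqrt_nonneg A).posSemidef

theorem msqrt_mul_self (hA : A.PosSemidef) : msqrt A * msqrt A = A :=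
  CFC.sqrt_mul_sqrt_self A hA.nonneg

theorem msqrt_eq_of_mul_self (hB : B.PosSemidef) (h : B * B = A) : msqrt A = B :=
  CFC.sqrt_unique h hB.nonneg

theorem posDef_msqrt (hA : A.PosDef) : (msqrt A).PosDef :=
  (posSemidef_msqrt A).posDef_iff_isUnit.2 <|
    isUnit_of_mul_isUnit_left ((msqrt_mul_self hA.posSemidef).symm ▸ hA.isUnit)

end Msqrt

section GramOf

variable {m : Type*} [Fintype m] [DecidableEq m] {G M X : Matrix m m ℂ}

theorem ofReal_sqrt_re_mul_self {z : ℂ} (hz : 0 ≤ z) : (√z.re : ℂ) * √z.re = z := by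
  rw [← Complex.ofReal_mul, Real.mul_self_sqrt (Complex.nonneg_iff.1 hz).1,
    ← Complex.eq_re_of_ofReal_le hz]

theorem ofReal_sqrt_re_pos {z : ℂ} (hz : 0 < z) : 0 < (√z.re : ℂ) :=
  Complex.zero_lt_real.2 (Real.sqrt_pos.2 (Complex.pos_iff.1 hz).1)

/-- The inverse of `slackMatrix` on positive definite matrices: since `slackMatrix M` has diagonal
entries `(M i i)²`, its row `i` is divided by the square root of its `i`-th diagonal entry. -/
def factorOf (X : Matrix m m ℂ) : Matrix m m ℂ := diagonal (fun i => (√(X i i).re : ℂ)⁻¹) * X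

/-- The solution `G` of `X² = D G D` with `D²` the diagonal of `X`: the Gram matrix whose optimal
measurement has `slackMatrix` equal to `X`, for positive definite `X`. -/
def gramOf (X : Matrix m m ℂ) : Matrix m m ℂ := factorOf X * (factorOf X)ᴴ

theorem factorOf_apply (X : Matrix m m ℂ) (i j : m) :
    factorOf X i j = (√(X i i).re : ℂ)⁻¹ * X i j :=
  diagonal_mul _ _ _ _

theorem isFactor_factorOf (hX : X.PosDef) : IsFactor (gramOf X) (factorOf X) where
  mul_conjTranspose := rfl
  diag_nonneg i := by
    rw [factorOf_apply]
    exact (mul_pos (inv_pos.2 (ofReal_sqrt_re_pos hX.diag_pos)) hX.diag_pos).le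

theorem slackMatrix_factorOf (hX : X.PosDef) : slackMatrix (factorOf X) = X := by
  ext i j
  have hpos : (√(X i i).re : ℂ) ≠ 0 := (ofReal_sqrt_re_pos hX.diag_pos).ne'
  rw [slackMatrix_apply, factorOf_apply, factorOf_apply]
  field_simp
  rw [sq, ofReal_sqrt_re_mul_self hX.diag_pos.le]

theorem factorOf_slackMatrix (hX : (slackMatrix M).PosDef) (hM : ∀ i, 0 ≤ M i i) :
    factorOf (slackMatrix M) = M := by
  ext i j
  have hpos : 0 < M i i := diag_pos_of_posDef_slackMatrix hX (hM i)
  obtain ⟨r, hr, hrM⟩ : ∃ r : ℝ, 0 < r ∧ (r : ℂ) = M i i := RCLike.pos_iff_exists_ofReal.1 hpos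
  have hsqrt : (√(slackMatrix M i i).re : ℂ) = M i i := by
    rw [slackMatrix_apply, ← hrM, ← Complex.ofReal_mul, Complex.ofReal_re,
      Real.sqrt_mul_self hr.le]
  rw [factorOf_apply, hsqrt, slackMatrix_apply, inv_mul_cancel_left₀ hpos.ne']

theorem gramOf_slackMatrix (h : IsFactor G M) (hX : (slackMatrix M).PosDef) :
    gramOf (slackMatrix M) = G := by
  rw [gramOf, factorOf_slackMatrix hX h.diag_nonneg, h.mul_conjTranspose]

theorem gramOf_eq (hX : X.IsHermitian) :
    gramOf X = diagonal (fun i => (√(X i i).re : ℂ)⁻¹) * (X * X) *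
      diagonal (fun i => (√(X i i).re : ℂ)⁻¹) := by
  have hstar : star (fun i => (√(X i i).re : ℂ)⁻¹) = fun i => (√(X i i).re : ℂ)⁻¹ := by
    ext i
    rw [Pi.star_apply, star_inv₀, Complex.star_def, Complex.conj_ofReal]
  simp only [gramOf, factorOf, conjTranspose_mul, diagonal_conjTranspose, hstar, hX.eq,
    Matrix.mul_assoc]

theorem posDef_gramOf (hX : X.PosDef) : (gramOf X).PosDef := by
  have hunit : IsUnit (factorOf X) :=
    isUnit_of_isUnit_slackMatrix ((slackMatrix_factorOf hX).symm ▸ hX.isUnit)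
  exact PosDef.mul_conjTranspose_self _ (vecMul_injective_of_isUnit hunit)

theorem gramOf_smul (X : Matrix m m ℂ) {r : ℝ} (hr : 0 ≤ r) :
    gramOf ((r : ℂ) • X) = (r : ℂ) • gramOf X := by
  have hfactor : factorOf ((r : ℂ) • X) = (√r : ℂ) • factorOf X := by
    ext i j
    have hr' : (r : ℂ) = √r * √r := by rw [← Complex.ofReal_mul, Real.mul_self_sqrt hr]
    rw [Matrix.smul_apply, factorOf_apply, factorOf_apply, Matrix.smul_apply, Matrix.smul_apply,
      smul_eq_mul, smul_eq_mul, smul_eq_mul, Complex.re_ofReal_mul, Real.sqrt_mul hr,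
      Complex.ofReal_mul, hr', mul_inv]
    rcases eq_or_ne (√r : ℂ) 0 with h0 | h0
    · simp only [h0, zero_mul, mul_zero]
    · field_simp
  rw [gramOf, hfactor, conjTranspose_smul, smul_mul_smul_comm, Complex.star_def,
    Complex.conj_ofReal, ← Complex.ofReal_mul, Real.mul_self_sqrt hr, gramOf]

theorem injOn_gramOf : Set.InjOn (gramOf (m := m)) {X | X.PosDef} := by
  have eq_of_trace_le {X Y : Matrix m m ℂ} (hX : X.PosDef) (hY : Y.PosDef)
      (h : gramOf X = gramOf Y) (hle : X.trace ≤ Y.trace) : X = Y := by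
    have hfactor : factorOf X = factorOf Y :=
      (isFactor_factorOf hX).eq_of_trace_le (h ▸ isFactor_factorOf hY)
        (by rwa [slackMatrix_factorOf hX])
        (by rwa [slackMatrix_factorOf hX, slackMatrix_factorOf hY])
    rw [← slackMatrix_factorOf hX, hfactor, slackMatrix_factorOf hY]
  intro X hX Y hY h
  obtain ⟨x, -, hx⟩ : ∃ x : ℝ, 0 ≤ x ∧ (x : ℂ) = X.trace :=
    RCLike.nonneg_iff_exists_ofReal.1 hX.posSemidef.trace_nonneg
  obtain ⟨y, -, hy⟩ : ∃ y : ℝ, 0 ≤ y ∧ (y : ℂ) = Y.trace :=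
    RCLike.nonneg_iff_exists_ofReal.1 hY.posSemidef.trace_nonneg
  rcases le_total x y with hle | hle
  · exact eq_of_trace_le hX hY h (by rw [← hx, ← hy]; exact Complex.real_le_real.2 hle)
  · exact (eq_of_trace_le hY hX h.symm (by rw [← hx, ← hy]; exact Complex.real_le_real.2 hle)).symm

theorem exists_posDef_gramOf_eq (hG : G.PosDef) : ∃ X, X.PosDef ∧ gramOf X = G := by
  obtain ⟨M, hM, hX⟩ := exists_isFactor_posDef_slackMatrix hG
  exact ⟨slackMatrix M, hX, gramOf_slackMatrix hM hX⟩

end GramOf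

/-- `A` rescaled to trace one, as `R_G` does with `X²` (the zero matrix if `A` has trace zero). -/
def traceNormalize {𝕜 m : Type*} [RCLike 𝕜] [Fintype m] (A : Matrix m m 𝕜) : Matrix m m 𝕜 :=
  A.trace⁻¹ • A

section RG

variable {n : ℕ} {G Q X : Matrix (Fin n) (Fin n) ℂ} {d : Fin n → ℝ}

theorem nonempty_fin_of_mem_gramSet (hG : G ∈ gramSet n) : Nonempty (Fin n) := by
  by_contra h
  have : IsEmpty (Fin n) := not_nonempty_iff.1 h
  exact zero_ne_one ((trace_eq_zero_of_isEmpty G).symm.trans hG.2)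

theorem trace_gramOf_msqrt (hQ : Q.PosDef) :
    (gramOf (msqrt Q)).trace = ((normConst Q)⁻¹ : ℝ) := by
  rw [gramOf_eq (posSemidef_msqrt Q).isHermitian, msqrt_mul_self hQ.posSemidef, normConst, inv_inv,
    Complex.ofReal_sum]
  refine Finset.sum_congr rfl fun i _ => ?_
  have hR := (posDef_msqrt hQ).diag_pos (i := i)
  have hr : (√(msqrt Q i i).re : ℂ) * √(msqrt Q i i).re = (msqrt Q i i).re := by
    rw [ofReal_sqrt_re_mul_self hR.le, ← Complex.eq_re_of_ofReal_le hR.le]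
  rw [diag_apply, mul_diagonal, diagonal_mul, Complex.ofReal_div,
    ← Complex.eq_re_of_ofReal_le hQ.diag_pos.le, ← hr]
  field_simp

theorem normConst_pos (hQ : Q ∈ gramSet n) : 0 < normConst Q := by
  have := nonempty_fin_of_mem_gramSet hQ
  have h := (posDef_gramOf (posDef_msqrt hQ.1)).trace_pos
  rwa [trace_gramOf_msqrt hQ.1, Complex.zero_lt_real, inv_pos] at h

theorem RGinv_eq_gramOf (hQ : Q ∈ gramSet n) :
    RGinv Q = gramOf ((normConst Q : ℂ) • msqrt Q) := by
  have hC := normConst_pos hQ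
  rw [gramOf_smul _ hC.le, gramOf_eq (posSemidef_msqrt Q).isHermitian,
    msqrt_mul_self hQ.1.posSemidef]
  ext i j
  have hq (k : Fin n) : 0 < (Q k k).re := (Complex.pos_iff.1 hQ.1.diag_pos).1
  have hr (k : Fin n) : 0 < (msqrt Q k k).re :=
    (Complex.pos_iff.1 (posDef_msqrt hQ.1).diag_pos).1
  have hsqrt : √(priorOf Q i * priorOf Q j) / √((Q i i).re * (Q j j).re) =
      normConst Q * (√(msqrt Q i i).re)⁻¹ * (√(msqrt Q j j).re)⁻¹ := by
    rw [← Real.sqrt_div' _ (mul_pos (hq i) (hq j)).le, ← Real.sqrt_inv, ← Real.sqrt_inv, mul_assoc,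
      ← Real.sqrt_mul (inv_pos.2 (hr i)).le]
    conv_rhs => rw [← Real.sqrt_sq hC.le, ← Real.sqrt_mul (sq_nonneg _)]
    congr 1
    have := (hq i).ne'
    have := (hq j).ne'
    simp only [priorOf]
    field_simp
  rw [Matrix.smul_apply, mul_diagonal, diagonal_mul, smul_eq_mul, RGinv, of_apply,
    mul_div_left_comm, ← Complex.ofReal_div, hsqrt]
  push_cast
  ring

theorem posDef_normConst_smul_msqrt (hQ : Q ∈ gramSet n) :
    ((normConst Q : ℂ) • msqrt Q).PosDef :=
  (posDef_msqrt hQ.1).smul (Complex.zero_lt_real.2 (normConst_pos hQ))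

theorem mapsTo_RGinv : Set.MapsTo (RGinv (n := n)) (gramSet n) (gramSet n) := by
  intro Q hQ
  rw [RGinv_eq_gramOf hQ]
  refine ⟨posDef_gramOf (posDef_normConst_smul_msqrt hQ), ?_⟩
  rw [gramOf_smul _ (normConst_pos hQ).le, trace_smul, trace_gramOf_msqrt hQ.1, smul_eq_mul,
    ← Complex.ofReal_mul, mul_inv_cancel₀ (normConst_pos hQ).ne', Complex.ofReal_one]

theorem traceNormalize_normConst_smul_msqrt (hQ : Q ∈ gramSet n) :
    traceNormalize (((normConst Q : ℂ) • msqrt Q) * ((normConst Q : ℂ) • msqrt Q)) = Q := by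
  have hC : (normConst Q : ℂ) ≠ 0 := Complex.ofReal_ne_zero.2 (normConst_pos hQ).ne'
  rw [traceNormalize, smul_mul_smul_comm, msqrt_mul_self hQ.1.posSemidef, trace_smul, hQ.2,
    smul_eq_mul, mul_one, inv_smul_smul₀ (mul_ne_zero hC hC)]

theorem injOn_RGinv : Set.InjOn (RGinv (n := n)) (gramSet n) := by
  intro Q hQ Q' hQ' h
  rw [RGinv_eq_gramOf hQ, RGinv_eq_gramOf hQ'] at h
  rw [← traceNormalize_normConst_smul_msqrt hQ, ← traceNormalize_normConst_smul_msqrt hQ',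
    injOn_gramOf (posDef_normConst_smul_msqrt hQ) (posDef_normConst_smul_msqrt hQ') h]

theorem traceNormalize_mem_gramSet [Nonempty (Fin n)] (hX : X.PosDef) :
    traceNormalize X ∈ gramSet n :=
  ⟨hX.smul (inv_pos.2 hX.trace_pos), by
    rw [traceNormalize, trace_smul, smul_eq_mul, inv_mul_cancel₀ hX.trace_pos.ne']⟩

theorem normConst_smul_msqrt_traceNormalize (hX : X.PosDef) (hG : gramOf X ∈ gramSet n) :
    (normConst (traceNormalize (X * X)) : ℂ) • msqrt (traceNormalize (X * X)) = X := by
  have := nonempty_fin_of_mem_gramSet hG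
  have hQ := traceNormalize_mem_gramSet (posDef_mul_self hX)
  obtain ⟨t, ht, htX⟩ : ∃ t : ℝ, 0 < t ∧ (t : ℂ) = (X * X).trace :=
    RCLike.pos_iff_exists_ofReal.1 (posDef_mul_self hX).trace_pos
  have hc : (0 : ℝ) < (√t)⁻¹ := inv_pos.2 (Real.sqrt_pos.2 ht)
  have hsqrt : msqrt (traceNormalize (X * X)) = (((√t)⁻¹ : ℝ) : ℂ) • X := by
    refine msqrt_eq_of_mul_self (hX.smul (Complex.zero_lt_real.2 hc)).posSemidef ?_
    rw [smul_mul_smul_comm, traceNormalize, ← htX, ← Complex.ofReal_mul, ← mul_inv,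
      Real.mul_self_sqrt ht.le, Complex.ofReal_inv]
  have hconst : normConst (traceNormalize (X * X)) = √t := by
    have htrace := trace_gramOf_msqrt hQ.1
    rw [hsqrt, gramOf_smul _ hc.le, trace_smul, hG.2, smul_eq_mul, mul_one] at htrace
    exact (inv_injective (Complex.ofReal_injective htrace)).symm
  rw [hsqrt, hconst, smul_smul, ← Complex.ofReal_mul,
    mul_inv_cancel₀ (Real.sqrt_pos.2 ht).ne', Complex.ofReal_one, one_smul]

theorem RGinv_traceNormalize (hX : X.PosDef) (hG : gramOf X ∈ gramSet n) :
    RGinv (traceNormalize (X * X)) = gramOf X := by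
  have := nonempty_fin_of_mem_gramSet hG
  rw [RGinv_eq_gramOf (traceNormalize_mem_gramSet (posDef_mul_self hX)),
    normConst_smul_msqrt_traceNormalize hX hG]

theorem bijOn_RGinv : Set.BijOn (RGinv (n := n)) (gramSet n) (gramSet n) := by
  refine ⟨mapsTo_RGinv, injOn_RGinv, fun G hG => ?_⟩
  have := nonempty_fin_of_mem_gramSet hG
  obtain ⟨X, hX, rfl⟩ := exists_posDef_gramOf_eq hG.1
  exact ⟨_, traceNormalize_mem_gramSet (posDef_mul_self hX), RGinv_traceNormalize hX hG⟩

theorem RG_gramOf (hX : X.PosDef) (hG : gramOf X ∈ gramSet n) :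
    RG (gramOf X) = traceNormalize (X * X) := by
  have := nonempty_fin_of_mem_gramSet hG
  rw [← RGinv_traceNormalize hX hG]
  exact injOn_RGinv.leftInvOn_invFunOn (traceNormalize_mem_gramSet (posDef_mul_self hX))

theorem IsMatrixSolution.ofReal_sqrt_re (h : IsMatrixSolution G X d) (i : Fin n) :
    (√(X i i).re : ℂ) = d i := by
  rw [h.diag, ← Complex.ofReal_pow, Complex.ofReal_re, Real.sqrt_sq (h.nonneg i)]

theorem IsMatrixSolution.gramOf_eq (h : IsMatrixSolution G X d) (hX : X.PosDef) : gramOf X = G := by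
  have hd (i : Fin n) : (d i : ℂ) ≠ 0 :=
    h.ofReal_sqrt_re i ▸ (ofReal_sqrt_re_pos hX.diag_pos).ne'
  ext i j
  rw [MED.gramOf_eq h.herm, h.eq, mul_diagonal, diagonal_mul, mul_diagonal, diagonal_mul,
    h.ofReal_sqrt_re, h.ofReal_sqrt_re, ← mul_assoc, inv_mul_cancel_left₀ (hd i),
    mul_inv_cancel_right₀ (hd j)]

theorem IsMatrixSolution.RG_eq (h : IsMatrixSolution G X d) (hX : X.PosDef) (hG : G ∈ gramSet n) :
    RG G = ((diagonal (fun i => (d i : ℂ)) ^ 2 * G).trace)⁻¹ •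
      (diagonal (fun i => (d i : ℂ)) * G * diagonal (fun i => (d i : ℂ))) := by
  have hgram := h.gramOf_eq hX
  rw [← hgram, RG_gramOf hX (hgram.symm ▸ hG), hgram, traceNormalize, h.eq, trace_mul_comm, sq,
    ← Matrix.mul_assoc]

theorem IsFactor.isMatrixSolution {M : Matrix (Fin n) (Fin n) ℂ} (h : IsFactor G M)
    (hX : (slackMatrix M).IsHermitian) :
    IsMatrixSolution G (slackMatrix M) (fun i => (M i i).re) := by
  have hre (i : Fin n) : ((M i i).re : ℂ) = M i i :=
    (Complex.eq_re_of_ofReal_le (h.diag_nonneg i)).symm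
  refine ⟨hX, fun i => (Complex.nonneg_iff.1 (h.diag_nonneg i)).1, fun i => ?_, ?_⟩
  · rw [hre, slackMatrix_apply, sq]
  · have hD : star M.diag = M.diag :=
      funext fun i => (IsSelfAdjoint.of_nonneg (h.diag_nonneg i)).star_eq
    calc slackMatrix M * slackMatrix M = slackMatrix M * (slackMatrix M)ᴴ := by rw [hX.eq]
      _ = diagonal M.diag * (M * Mᴴ) * diagonal M.diag := by
        simp only [slackMatrix, conjTranspose_mul, diagonal_conjTranspose, hD, Matrix.mul_assoc]
      _ = _ := by
        rw [h.mul_conjTranspose]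
        simp only [hre]
        rfl

end RG

section OpMatrix

variable {𝕜 ι V : Type*} [RCLike 𝕜] [Fintype ι] [DecidableEq ι] [NormedAddCommGroup V]
  [InnerProductSpace 𝕜 V]

/-- The matrix `⟨w k|F (w l)⟩` of an operator `F` in the orthonormal basis `w`. -/
def opMatrix (w : OrthonormalBasis ι 𝕜 V) : (V →L[𝕜] V) ≃ₐ[𝕜] Matrix ι ι 𝕜 :=
  haveI := w.toBasis.finiteDimensional_of_finite
  (Module.End.toContinuousLinearMap V).symm.trans (LinearMap.toMatrixAlgEquiv w.toBasis)

theorem opMatrix_apply (w : OrthonormalBasis ι 𝕜 V) (F : V →L[𝕜] V) (k l : ι) :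
    opMatrix w F k l = inner 𝕜 (w k) (F (w l)) := by
  rw [← w.repr_apply_apply, ← w.coe_toBasis_repr_apply, ← w.coe_toBasis]
  exact LinearMap.toMatrixAlgEquiv_apply _ _ _ _

theorem posSemidef_opMatrix_iff (w : OrthonormalBasis ι 𝕜 V) {F : V →L[𝕜] V} :
    (opMatrix w F).PosSemidef ↔ F.IsPositive :=
  (LinearMap.posSemidef_toMatrix_iff w).trans (ContinuousLinearMap.isPositive_toLinearMap_iff F)

theorem inner_apply_eq_sum_opMatrix (w : OrthonormalBasis ι 𝕜 V) (F : V →L[𝕜] V) (x y : V) :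
    inner 𝕜 x (F y) = ∑ l, (∑ k, inner 𝕜 x (w k) * opMatrix w F k l) * inner 𝕜 (w l) y := by
  have hFy : F y = ∑ l, inner 𝕜 (w l) y • F (w l) := by
    simp only [← map_smul, ← map_sum, w.sum_repr']
  simp only [opMatrix_apply, w.sum_inner_mul_inner]
  rw [hFy, inner_sum]
  exact Finset.sum_congr rfl fun l _ => (inner_smul_right _ _ _).trans (mul_comm _ _)

end OpMatrix

section Discrimination

variable {n : ℕ} {H : Type*} [NormedAddCommGroup H] [InnerProductSpace ℂ H]
  {w : OrthonormalBasis (Fin n) ℂ H} {W M : Matrix (Fin n) (Fin n) ℂ}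

theorem isPOVM_proj (w : OrthonormalBasis (Fin n) ℂ H) : IsPOVM (proj w) :=
  ⟨fun _ => InnerProductSpace.isPositive_rankOne_self _, w.sum_rankOne_eq_id⟩

theorem opMatrix_proj (w : OrthonormalBasis (Fin n) ℂ H) (i : Fin n) :
    opMatrix w (proj w i) = single i i 1 := by
  ext k l
  rw [opMatrix_apply, proj, ketbra, InnerProductSpace.rankOne_apply, inner_smul_right,
    w.inner_eq_ite, w.inner_eq_ite, single_apply, mul_ite, mul_one, mul_zero, ← ite_and]
  simp only [eq_comm]

namespace Ensemble

variable (P : Ensemble n H)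

theorem ofReal_sqrt_mul_self (i : Fin n) : (√(P.p i) : ℂ) * √(P.p i) = P.p i := by
  rw [← Complex.ofReal_mul, Real.mul_self_sqrt (P.p_pos i).le]

theorem ketbra_tilde (i : Fin n) : ketbra (P.tilde i) = (P.p i : ℂ) • ketbra (P.ψ i) := by
  ext v
  simp only [ketbra, tilde, InnerProductSpace.rankOne_apply, _root_.smul_apply, inner_smul_left,
    smul_smul, Complex.conj_ofReal, ← P.ofReal_sqrt_mul_self i, mul_right_comm]

theorem inner_tilde_apply (F : H →L[ℂ] H) (i : Fin n) :
    inner ℂ (P.tilde i) (F (P.tilde i)) = P.p i * inner ℂ (P.ψ i) (F (P.ψ i)) := by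
  rw [tilde, map_smul, inner_smul_left, inner_smul_right, Complex.conj_ofReal, ← mul_assoc,
    P.ofReal_sqrt_mul_self]

theorem gram_apply_self (i : Fin n) : P.gram i i = P.p i := by
  have h := P.inner_tilde_apply 1 i
  rw [one_apply_eq_self, one_apply_eq_self, inner_self_eq_norm_sq_to_K (P.ψ i), P.norm_ψ,
    RCLike.ofReal_one, one_pow, mul_one] at h
  exact h

theorem gram_mem_gramSet : P.gram ∈ gramSet n := by
  refine ⟨P.gram_posDef, ?_⟩
  simp only [trace, diag_apply, gram_apply_self]
  rw [← Complex.ofReal_sum, P.p_sum, Complex.ofReal_one]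

theorem finiteDimensional (P : Ensemble n H) : FiniteDimensional ℂ H :=
  (Module.Basis.mk P.indep P.span_top.ge).finiteDimensional_of_finite

theorem finrank_eq (P : Ensemble n H) : Module.finrank ℂ H = n := by
  rw [Module.finrank_eq_card_basis (Module.Basis.mk P.indep P.span_top.ge), Fintype.card_fin]

theorem inner_tilde_sum_smul_u (a : Fin n → ℂ) (k : Fin n) :
    inner ℂ (P.tilde k) (∑ j, a j • P.u j) = a k := by
  simp only [inner_sum, inner_smul_right, P.inner_tilde_u, mul_ite, mul_one, mul_zero,
    Finset.sum_ite_eq, Finset.mem_univ, if_true]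

theorem inner_u_u (j k : Fin n) : inner ℂ (P.u j) (P.u k) = P.gram⁻¹ j k := by
  conv_lhs => rw [u]
  simp only [sum_inner, inner_smul_left, P.inner_tilde_u, mul_ite, mul_one, mul_zero,
    Finset.sum_ite_eq', Finset.mem_univ, if_true]
  exact P.gram_posDef.inv.isHermitian.apply j k

theorem gram_sum_smul_u (M : Matrix (Fin n) (Fin n) ℂ) :
    Matrix.gram ℂ (fun i => ∑ j, M j i • P.u j) = Mᴴ * P.gram⁻¹ * M := by
  ext i k
  simp only [gram_apply, sum_inner, inner_sum, inner_smul_left, inner_smul_right, P.inner_u_u,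
    mul_apply, conjTranspose_apply, Finset.sum_mul, RCLike.star_def]
  refine Finset.sum_congr rfl fun k _ => ?_
  rw [Finset.mul_sum]
  exact Finset.sum_congr rfl fun l _ => by ring

theorem eq_of_forall_inner_tilde_eq {x y : H}
    (h : ∀ k, inner ℂ (P.tilde k) x = inner ℂ (P.tilde k) y) : x = y := by
  refine InnerProductSpace.ext_inner_left_basis (Module.Basis.mk P.indep P.span_top.ge) fun k => ?_
  have hk := h k
  have hp : (√(P.p k) : ℂ) ≠ 0 := Complex.ofReal_ne_zero.2 (Real.sqrt_pos.2 (P.p_pos k)).ne'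
  rw [tilde, inner_smul_left, inner_smul_left, Complex.conj_ofReal] at hk
  rw [Module.Basis.mk_apply, mul_left_cancel₀ hp hk]

/-- The overlap matrix `⟨√(p k) ψ k|w i⟩` of the ensemble with an orthonormal basis: the matrix
`G^(1/2) W` of a rank-one projective solution, see `IsProjSolution.overlap_eq`. -/
def overlap (w : OrthonormalBasis (Fin n) ℂ H) : Matrix (Fin n) (Fin n) ℂ :=
  of fun k i => inner ℂ (P.tilde k) (w i)

theorem sum_overlap_smul_u (w : OrthonormalBasis (Fin n) ℂ H) (i : Fin n) :
    ∑ j, P.overlap w j i • P.u j = w i :=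
  P.eq_of_forall_inner_tilde_eq fun k => P.inner_tilde_sum_smul_u (fun j => P.overlap w j i) k

theorem conjTranspose_overlap_apply (w : OrthonormalBasis (Fin n) ℂ H) (i k : Fin n) :
    (P.overlap w)ᴴ i k = inner ℂ (w i) (P.tilde k) :=
  inner_conj_symm _ _

theorem overlap_mul_opMatrix_mul_apply (w : OrthonormalBasis (Fin n) ℂ H) (F : H →L[ℂ] H)
    (i j : Fin n) : (P.overlap w * opMatrix w F * (P.overlap w)ᴴ) i j =
      inner ℂ (P.tilde i) (F (P.tilde j)) := by
  rw [inner_apply_eq_sum_opMatrix w]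
  simp only [mul_apply, P.conjTranspose_overlap_apply]
  rfl

theorem overlap_mul_conjTranspose (w : OrthonormalBasis (Fin n) ℂ H) :
    P.overlap w * (P.overlap w)ᴴ = P.gram := by
  ext i j
  have h := P.overlap_mul_opMatrix_mul_apply w 1 i j
  rwa [map_one, Matrix.mul_one] at h

theorem isUnit_overlap (w : OrthonormalBasis (Fin n) ℂ H) : IsUnit (P.overlap w) :=
  isUnit_of_mul_isUnit_left ((P.overlap_mul_conjTranspose w).symm ▸ P.gram_posDef.isUnit)

theorem isFactor_overlap (hdiag : ∀ i, 0 ≤ P.overlap w i i) : IsFactor P.gram (P.overlap w) :=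
  ⟨P.overlap_mul_conjTranspose w, hdiag⟩

theorem exists_overlap_eq (hM : M * Mᴴ = P.gram) : ∃ w, P.overlap w = M := by
  have hunit : IsUnit M := isUnit_of_mul_isUnit_left (hM ▸ P.gram_posDef.isUnit)
  have horth : Orthonormal ℂ fun i => ∑ j, M j i • P.u j := by
    rw [← gram_eq_one_iff_orthonormal, gram_sum_smul_u, ← hM, Matrix.mul_inv_rev,
      ← Matrix.mul_assoc, mul_nonsing_inv Mᴴ ((isUnit_iff_isUnit_det _).1 hunit.star),
      Matrix.one_mul, nonsing_inv_mul _ ((isUnit_iff_isUnit_det _).1 hunit)]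
  have := P.finiteDimensional
  have hspan := horth.linearIndependent.span_eq_top_of_card_eq_finrank'
    ((Fintype.card_fin n).trans P.finrank_eq.symm)
  refine ⟨OrthonormalBasis.mk horth hspan.ge, ?_⟩
  ext k i
  rw [overlap, of_apply, OrthonormalBasis.coe_mk]
  exact P.inner_tilde_sum_smul_u (fun j => M j i) k

theorem opMatrix_ketbra_tilde (w : OrthonormalBasis (Fin n) ℂ H) (i : Fin n) :
    opMatrix w (ketbra (P.tilde i)) = (P.overlap w)ᴴ * single i i 1 * P.overlap w := by
  ext k l
  rw [mul_single_mul_apply, P.conjTranspose_overlap_apply, opMatrix_apply, ketbra,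
    InnerProductSpace.rankOne_apply, inner_smul_right, mul_comm]
  rfl

theorem slack_proj_iff (hdiag : ∀ i, 0 ≤ P.overlap w i i) :
    P.Slack (proj w) ↔ (slackMatrix (P.overlap w)).IsHermitian := by
  rw [IsHermitian.ext_iff, forall_comm]
  refine forall₂_congr fun i j => ?_
  have hprod : opMatrix w (proj w j *
      ((P.p j : ℂ) • ketbra (P.ψ j) - (P.p i : ℂ) • ketbra (P.ψ i)) * proj w i) =
      single j i (slackMatrix (P.overlap w) j i - star (slackMatrix (P.overlap w) i j)) := by
    rw [← P.ketbra_tilde, ← P.ketbra_tilde, map_mul, map_mul, map_sub, opMatrix_proj,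
      opMatrix_proj, P.opMatrix_ketbra_tilde, P.opMatrix_ketbra_tilde, single_mul_mul_single,
      Matrix.sub_apply, mul_single_mul_apply, mul_single_mul_apply, one_mul, mul_one,
      conjTranspose_apply, conjTranspose_apply, (IsSelfAdjoint.of_nonneg (hdiag j)).star_eq,
      slackMatrix_apply, slackMatrix_apply, star_mul, (IsSelfAdjoint.of_nonneg (hdiag i)).star_eq]
  rw [← map_eq_zero_iff _ (opMatrix w).injective, hprod]
  exact ⟨fun h => (sub_eq_zero.1 ((single_apply_same j i _).symm.trans (congr_fun₂ h j i))).symm,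
    fun h => by rw [h, sub_self, single_zero]⟩

theorem ofReal_successProb (w : OrthonormalBasis (Fin n) ℂ H) {E : Fin n → H →L[ℂ] H}
    (hE : ∀ i, (E i).IsPositive) : (P.successProb E : ℂ) =
      ∑ i, (P.overlap w * opMatrix w (E i) * (P.overlap w)ᴴ) i i := by
  rw [successProb, Complex.ofReal_sum]
  refine Finset.sum_congr rfl fun i _ => ?_
  rw [P.overlap_mul_opMatrix_mul_apply, P.inner_tilde_apply, Complex.ofReal_mul,
    ← Complex.eq_re_of_ofReal_le ((hE i).inner_nonneg_right (P.ψ i))]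

theorem ofReal_successProb_proj (hdiag : ∀ i, 0 ≤ P.overlap w i i) :
    (P.successProb (proj w) : ℂ) = (slackMatrix (P.overlap w)).trace := by
  rw [P.ofReal_successProb w (isPOVM_proj w).1]
  refine Finset.sum_congr rfl fun i _ => ?_
  rw [opMatrix_proj, mul_single_mul_apply, diag_apply, slackMatrix_apply, conjTranspose_apply,
    (IsSelfAdjoint.of_nonneg (hdiag i)).star_eq]

theorem isOptimal_proj (hdiag : ∀ i, 0 ≤ P.overlap w i i)
    (hX : (slackMatrix (P.overlap w)).PosDef) : P.IsOptimal (proj w) := by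
  refine ⟨isPOVM_proj w, fun F hF => Complex.real_le_real.1 ?_⟩
  rw [P.ofReal_successProb_proj hdiag, P.ofReal_successProb w hF.1]
  exact sum_mul_mul_conjTranspose_le_trace_slackMatrix
    (fun i => (posSemidef_opMatrix_iff w).2 (hF.1 i)) (by rw [← map_sum, hF.2, map_one]) hX hdiag

theorem eq_proj_of_isOptimal (hdiag : ∀ i, 0 ≤ P.overlap w i i)
    (hX : (slackMatrix (P.overlap w)).PosDef) {E : Fin n → H →L[ℂ] H} (hE : P.IsOptimal E) :
    E = proj w := by
  have hprob : P.successProb E = P.successProb (proj w) :=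
    le_antisymm ((P.isOptimal_proj hdiag hX).2 E hE.1) (hE.2 _ (isPOVM_proj w))
  funext i
  apply (opMatrix w).injective
  rw [opMatrix_proj]
  exact eq_single_of_sum_mul_mul_conjTranspose_eq (E := fun i => opMatrix w (E i))
    (fun i => (posSemidef_opMatrix_iff w).2 (hE.1.1 i)) (by rw [← map_sum, hE.1.2, map_one]) hX
    hdiag (by rw [← P.ofReal_successProb w hE.1.1, hprob, P.ofReal_successProb_proj hdiag]) i

theorem exists_overlap_posDef_slackMatrix :
    ∃ w, (∀ i, 0 ≤ P.overlap w i i) ∧ (slackMatrix (P.overlap w)).PosDef := by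
  obtain ⟨M, hM, hX⟩ := exists_isFactor_posDef_slackMatrix P.gram_posDef
  obtain ⟨w, rfl⟩ := P.exists_overlap_eq hM.mul_conjTranspose
  exact ⟨w, hM.diag_nonneg, hX⟩

theorem posDef_slackMatrix_of_isOptimal (hdiag : ∀ i, 0 ≤ P.overlap w i i)
    (hopt : P.IsOptimal (proj w)) : (slackMatrix (P.overlap w)).PosDef := by
  obtain ⟨w', hdiag', hX'⟩ := P.exists_overlap_posDef_slackMatrix
  have hle : (slackMatrix (P.overlap w')).trace ≤ (slackMatrix (P.overlap w)).trace := by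
    rw [← P.ofReal_successProb_proj hdiag, ← P.ofReal_successProb_proj hdiag']
    exact Complex.real_le_real.2 (hopt.2 _ (isPOVM_proj w'))
  rwa [← (P.isFactor_overlap hdiag').eq_of_trace_le (P.isFactor_overlap hdiag) hX' hle]

theorem exists_mem_unitaryGroup_overlap_eq (w : OrthonormalBasis (Fin n) ℂ H) :
    ∃ W ∈ unitaryGroup (Fin n) ℂ, P.overlap w = msqrt P.gram * W := by
  have hS := (posSemidef_msqrt P.gram).isHermitian
  obtain ⟨W, hW, h⟩ := exists_mul_eq_of_mul_conjTranspose_eq (M := msqrt P.gram)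
    (M' := P.overlap w) (posDef_msqrt P.gram_posDef).isUnit (by
      rw [hS.eq, msqrt_mul_self P.gram_posDef.posSemidef, P.overlap_mul_conjTranspose])
  exact ⟨W, mem_unitaryGroup_iff.2 hW, h.symm⟩

theorem X_eq_slackMatrix (W : Matrix (Fin n) (Fin n) ℂ) :
    P.X W = slackMatrix (msqrt P.gram * W) :=
  Matrix.mul_assoc _ _ _

variable {P}

namespace IsProjSolution

theorem overlap_eq (h : P.IsProjSolution w W) : P.overlap w = msqrt P.gram * W := by
  ext k i
  rw [overlap, of_apply, h.repr]
  exact P.inner_tilde_sum_smul_u (fun j => (msqrt P.gram * W) j i) k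

theorem overlap_diag_nonneg (h : P.IsProjSolution w W) (i : Fin n) : 0 ≤ P.overlap w i i := by
  rw [h.overlap_eq]
  exact Complex.nonneg_iff.2 ⟨h.diag_re i, (h.diag_im i).symm⟩

theorem X_eq (h : P.IsProjSolution w W) : P.X W = slackMatrix (P.overlap w) := by
  rw [X_eq_slackMatrix, h.overlap_eq]

theorem isMatrixSolution (h : P.IsProjSolution w W) :
    IsMatrixSolution P.gram (P.X W) (fun i => ((msqrt P.gram * W) i i).re) := by
  rw [h.X_eq, ← h.overlap_eq]
  exact (P.isFactor_overlap h.overlap_diag_nonneg).isMatrixSolution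
    ((P.slack_proj_iff h.overlap_diag_nonneg).1 h.slack)

theorem isOptimal_iff (h : P.IsProjSolution w W) : P.IsOptimal (proj w) ↔ (P.X W).PosDef := by
  rw [h.X_eq]
  exact ⟨P.posDef_slackMatrix_of_isOptimal h.overlap_diag_nonneg,
    P.isOptimal_proj h.overlap_diag_nonneg⟩

theorem D_eq (h : P.IsProjSolution w W) :
    P.D W = diagonal fun i => (((msqrt P.gram * W) i i).re : ℂ) :=
  congrArg diagonal <| funext fun i =>
    Complex.eq_re_of_ofReal_le (h.overlap_eq ▸ h.overlap_diag_nonneg i)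

end IsProjSolution

variable (P)

theorem exists_isProjSolution (hdiag : ∀ i, 0 ≤ P.overlap w i i)
    (hX : (slackMatrix (P.overlap w)).IsHermitian) :
    ∃ W, P.IsProjSolution w W ∧ P.X W = slackMatrix (P.overlap w) := by
  obtain ⟨W, hW, h⟩ := P.exists_mem_unitaryGroup_overlap_eq w
  have hW' : P.IsProjSolution w W := {
    unitary := hW
    repr := fun i => by rw [← h, P.sum_overlap_smul_u]
    diag_im := fun i => by rw [← h, ← (Complex.nonneg_iff.1 (hdiag i)).2]
    diag_re := fun i => by rw [← h]; exact (Complex.nonneg_iff.1 (hdiag i)).1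
    slack := (P.slack_proj_iff hdiag).2 hX }
  exact ⟨W, hW', hW'.X_eq⟩

theorem exists_isProjSolution_of_isMatrixSolution {X : Matrix (Fin n) (Fin n) ℂ} {d : Fin n → ℝ}
    (h : IsMatrixSolution P.gram X d) (hX : X.PosDef) :
    ∃ w W, P.IsProjSolution w W ∧ P.X W = X := by
  have hM : IsFactor P.gram (factorOf X) := h.gramOf_eq hX ▸ isFactor_factorOf hX
  obtain ⟨w, hw⟩ := P.exists_overlap_eq hM.mul_conjTranspose
  have hXw : slackMatrix (P.overlap w) = X := by rw [hw, slackMatrix_factorOf hX]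
  obtain ⟨W, hW, hWX⟩ := P.exists_isProjSolution (hw ▸ hM.diag_nonneg) (hXw.symm ▸ hX.isHermitian)
  exact ⟨w, W, hW, hWX.trans hXw⟩

theorem pgm_eq_proj [CompleteSpace H] (hw : (P.overlap w).PosSemidef) : P.pgm = proj w := by
  obtain ⟨S, hS⟩ := (opMatrix w).surjective (P.overlap w)
  have hketbra (i : Fin n) : (P.p i : ℂ) • ketbra (P.ψ i) = S * proj w i * S := by
    apply (opMatrix w).injective
    rw [← P.ketbra_tilde, P.opMatrix_ketbra_tilde, map_mul, map_mul, hS, opMatrix_proj,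
      hw.isHermitian.eq]
  have hdensity : S * S = P.density := by
    simp only [density, hketbra, ← Finset.sum_mul, ← Finset.mul_sum, (isPOVM_proj w).2, mul_one]
  have hSpos : 0 ≤ S :=
    (ContinuousLinearMap.nonneg_iff_isPositive S).2 ((posSemidef_opMatrix_iff w).1 (hS ▸ hw))
  have hSunit : IsUnit S :=
    (MulEquiv.isUnit_map (opMatrix w)).1 (hS.symm ▸ P.isUnit_overlap w)
  funext i
  rw [pgm, CFC.sqrt_unique hdensity hSpos, hketbra, mul_assoc S,
    Ring.inverse_mul_cancel_left _ _ hSunit, Ring.mul_inverse_cancel_right _ _ hSunit]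

theorem exists_overlap_eq_diagonal_mul (w : OrthonormalBasis (Fin n) ℂ H) {t : Fin n → ℝ}
    (ht : ∀ i, 0 < t i) (htrace : (diagonal (fun i => (t i : ℂ)) * P.overlap w *
      (diagonal (fun i => (t i : ℂ)) * P.overlap w)ᴴ).trace = 1) :
    ∃ Q : Ensemble n H, Q.ψ = P.ψ ∧ Q.overlap w = diagonal (fun i => (t i : ℂ)) * P.overlap w := by
  have hsum : ∑ i, t i ^ 2 * P.p i = 1 := by
    rw [conjTranspose_mul, diagonal_conjTranspose, Matrix.mul_assoc,
      ← Matrix.mul_assoc (P.overlap w), P.overlap_mul_conjTranspose, trace] at htrace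
    simp only [diag_apply, mul_diagonal, diagonal_mul, P.gram_apply_self, Pi.star_apply,
      RCLike.star_def, Complex.conj_ofReal] at htrace
    have h : ∑ i, t i * (P.p i * t i) = 1 := by exact_mod_cast htrace
    rw [← h]
    exact Finset.sum_congr rfl fun i _ => by ring
  refine ⟨{ P with
    p := fun i => t i ^ 2 * P.p i
    p_pos := fun i => mul_pos (pow_pos (ht i) 2) (P.p_pos i)
    p_sum := hsum }, rfl, ?_⟩
  ext k i
  have hsqrt : √(t k ^ 2 * P.p k) = t k * √(P.p k) := by
    rw [Real.sqrt_mul (sq_nonneg _), Real.sqrt_sq (ht k).le]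
  rw [diagonal_mul, overlap, overlap, of_apply, of_apply, tilde, tilde, inner_smul_left,
    inner_smul_left, hsqrt, Complex.conj_ofReal, Complex.conj_ofReal, Complex.ofReal_mul, mul_assoc]

theorem exists_pgm_eq_proj [CompleteSpace H] (hdiag : ∀ i, 0 ≤ P.overlap w i i)
    (hX : (slackMatrix (P.overlap w)).PosDef) :
    ∃ Q : Ensemble n H, Q.ψ = P.ψ ∧ Q.gram = RG P.gram ∧ Q.pgm = proj w ∧
      0 < normConst Q.gram ∧
      slackMatrix (P.overlap w) = (normConst Q.gram : ℂ) • msqrt Q.gram := by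
  have hgram := gramOf_slackMatrix (P.isFactor_overlap hdiag) hX
  have hG : gramOf (slackMatrix (P.overlap w)) ∈ gramSet n := hgram.symm ▸ P.gram_mem_gramSet
  have hRG : RG P.gram ∈ gramSet n := bijOn_RGinv.surjOn.mapsTo_invFunOn P.gram_mem_gramSet
  have hC : 0 < normConst (RG P.gram) := normConst_pos hRG
  have hXC : slackMatrix (P.overlap w) = (normConst (RG P.gram) : ℂ) • msqrt (RG P.gram) := by
    rw [← hgram, RG_gramOf hX hG, normConst_smul_msqrt_traceNormalize hX hG]
  let t : Fin n → ℝ := fun i => (normConst (RG P.gram))⁻¹ * (P.overlap w i i).re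
  have ht (i : Fin n) : 0 < t i := mul_pos (inv_pos.2 hC)
    (Complex.pos_iff.1 (diag_pos_of_posDef_slackMatrix hX (hdiag i))).1
  have hmsqrt : diagonal (fun i => (t i : ℂ)) * P.overlap w = msqrt (RG P.gram) := by
    rw [← inv_smul_smul₀ (Complex.ofReal_ne_zero.2 hC.ne') (msqrt (RG P.gram)), ← hXC]
    ext i j
    rw [diagonal_mul, Matrix.smul_apply, slackMatrix_apply, smul_eq_mul, Complex.ofReal_mul,
      Complex.ofReal_inv, ← Complex.eq_re_of_ofReal_le (hdiag i), mul_assoc]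
  have hsq : msqrt (RG P.gram) * (msqrt (RG P.gram))ᴴ = RG P.gram := by
    rw [(posSemidef_msqrt _).isHermitian.eq, msqrt_mul_self hRG.1.posSemidef]
  obtain ⟨Q, hψ, hQ⟩ := P.exists_overlap_eq_diagonal_mul w ht (by rw [hmsqrt, hsq, hRG.2])
  have hQw : Q.overlap w = msqrt (RG P.gram) := hQ.trans hmsqrt
  have hQgram : Q.gram = RG P.gram := by
    rw [← Q.overlap_mul_conjTranspose w, hQw, hsq]
  exact ⟨Q, hψ, hQgram, Q.pgm_eq_proj (hQw ▸ posSemidef_msqrt _), hQgram ▸ hC, hQgram ▸ hXC⟩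

end Ensemble

end Discrimination

end MED

end

open MED in
theorem theorem1 {n : ℕ} {H : Type*} [NormedAddCommGroup H] [InnerProductSpace ℂ H]
    [CompleteSpace H] (P : Ensemble n H) :
    -- the map `R_G` is well defined
    Set.BijOn (RGinv (n := n)) (gramSet n) (gramSet n) ∧
    -- the optimal measurement exists, is unique, and comes from a rank-one projective solution
    (∃! E : Fin n → H →L[ℂ] H, P.IsOptimal E) ∧
    (∃ w W, P.IsProjSolution w W ∧ P.IsOptimal (proj w)) ∧
    -- rank-one projective solutions of the complementary slackness conditions
    (∀ w W, P.IsProjSolution w W →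
      IsMatrixSolution P.gram (P.X W) (fun i => ((msqrt P.gram * W) i i).re) ∧
      (P.IsOptimal (proj w) ↔ (P.X W).PosDef) ∧
      (P.IsOptimal (proj w) →
        ∃ Q : Ensemble n H, Q.ψ = P.ψ ∧ Q.gram = RG P.gram ∧ Q.pgm = proj w ∧
          0 < normConst Q.gram ∧ P.X W = (normConst Q.gram : ℂ) • msqrt Q.gram ∧
          RG P.gram = ((P.D W ^ 2 * P.gram).trace)⁻¹ • (P.D W * P.gram * P.D W))) ∧
    -- arbitrary Hermitian solutions of the matrix equation
    (∀ X d, IsMatrixSolution P.gram X d →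
      (X.PosDef ↔ ∃ w W, P.IsProjSolution w W ∧ P.X W = X ∧ P.IsOptimal (proj w)) ∧
      (X.PosDef →
        RG P.gram =
          ((Matrix.diagonal (fun i => (d i : ℂ)) ^ 2 * P.gram).trace)⁻¹ •
            (Matrix.diagonal (fun i => (d i : ℂ)) * P.gram *
              Matrix.diagonal (fun i => (d i : ℂ))))) := by
  obtain ⟨w₀, hdiag, hX₀⟩ := P.exists_overlap_posDef_slackMatrix
  obtain ⟨W₀, hsol, -⟩ := P.exists_isProjSolution hdiag hX₀.isHermitian
  have hopt := P.isOptimal_proj hdiag hX₀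
  refine ⟨bijOn_RGinv, ⟨proj w₀, hopt, fun E hE => P.eq_proj_of_isOptimal hdiag hX₀ hE⟩,
    ⟨w₀, W₀, hsol, hopt⟩, fun w W h => ?_, fun X d h => ?_⟩
  · refine ⟨h.isMatrixSolution, h.isOptimal_iff, fun hopt => ?_⟩
    have hX : (P.X W).PosDef := h.isOptimal_iff.1 hopt
    obtain ⟨Q, hψ, hgram, hpgm, hC, hXC⟩ :=
      P.exists_pgm_eq_proj h.overlap_diag_nonneg (h.X_eq ▸ hX)
    exact ⟨Q, hψ, hgram, hpgm, hC, h.X_eq.trans hXC,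
      h.D_eq ▸ h.isMatrixSolution.RG_eq hX P.gram_mem_gramSet⟩
  · refine ⟨⟨fun hX => ?_, ?_⟩, fun hX => h.RG_eq hX P.gram_mem_gramSet⟩
    · obtain ⟨w, W, hw, rfl⟩ := P.exists_isProjSolution_of_isMatrixSolution h hX
      exact ⟨w, W, hw, rfl, hw.isOptimal_iff.2 hX⟩
    · rintro ⟨w, W, hw, rfl, hopt⟩
      exact hw.isOptimal_iff.1 hopt
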